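/- Let $M$ be a matroid on a finite ground set $E$ with a linear order $<$ on $E$. For $S\subseteq E$, let $\operatorname{EA}(S)$ be the set of $e\in E\setminus S$ such that some circuit $\gamma\subseteq S\cup\{e\}$ of $M$ has maximum element $e$; let $\operatorname{IA}(S)$ be the set of $i\in S$ that lie in $\operatorname{EA}(E\setminus S)$ computed in the dual matroid $M^\perp$; and let $\operatorname{IP}(S)=S\setminus\operatorname{IA}(S)$. An independent set $I$ is related to a basis $B$ if $I=B\setminus Y$ for some $Y\subseteq\operatorname{IA}(B)$, and two independent sets are internally related if they are related to a common basis. For bases, $A\leq_{ext/int}B$ means $(A\setminus \operatorname{IA}(A))\cup\operatorname{EA}(A)\subseteq (B\setminus \operatorname{IA}(B))\cup\operatorname{EA}(B)$. For independent sets, $I\leq_{ext/int}J$ means that either $I$ and $J$ are not internally related and $(I\setminus \operatorname{IA}(I))\cup\operatorname{EA}(I)\subseteq (J\setminus \operatorname{IA}(J))\cup\operatorname{EA}(J)$, or $I$ and $J$ are internally related and $I\subseteq J$. Proposition. Every independent set is related to exactly one basis. The order $\leq_{ext/int}$ makes the set $\mathcal B(M)$ of bases a lattice, with meet $\wedge^{\mathcal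 B}$ and join $\vee^{\mathcal B}$, and it makes the set $\mathcal I(M)$ of independent sets a lattice, with meet $\wedge$ and join $\vee$ given as follows. (1) If $I$ and $J$ are internally related, then $I\wedge J=I\cap J$ and $I\vee J=I\cup J$. (2) If $I$ and $J$ are related to bases $A$ and $B$, respectively, that are incomparable in $\leq_{ext/int}$, then $I\wedge J=A\wedge^{\mathcal B}B$ and $I\vee J=\operatorname{IP}(A\vee^{\mathcal B}B)$. (3) If $I$ and $J$ are related to bases $A$ and $B$, respectively, with $A<_{ext/int}B$, then $I\wedge J=I$ and $I\vee J=J$. -/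

import Mathlib

namespace Matroid

/-- The externally active elements of a set `S`: those `e` in `E \ S` that are the maximum of
some circuit contained in `S ∪ {e}`. -/
def extActive {α : Type*} [LinearOrder α] (M : Matroid α) (S : Set α) : Set α :=
  {e | e ∈ M.E \ S ∧ ∃ C : Set α, M.IsCircuit C ∧ C ⊆ insert e S ∧ IsGreatest C e}

/-- The internally active elements of `S`: those `i` in `S` that are externally active with
respect to `E \ S` in the dual matroid (with the same order). -/
def intActive {α : Type*} [LinearOrder α] (M : Matroid α) (S : Set α) : Set α :=
  {i | i ∈ S ∧ i ∈ M✶.extActive (M.E \ S)}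

/-- The internally passive elements of `S`. -/
def intPassive {α : Type*} [LinearOrder α] (M : Matroid α) (S : Set α) : Set α :=
  S \ M.intActive S

/-- `I` is obtained from the basis `B` by deleting internally active elements of `B`. -/
def IsRelatedToBase {α : Type*} [LinearOrder α] (M : Matroid α) (I B : Set α) : Prop :=
  M.IsBase B ∧ ∃ Y : Set α, Y ⊆ M.intActive B ∧ I = B \ Y

/-- Two sets are internally related if both are related to one and the same basis. -/
def InternallyRelated {α : Type*} [LinearOrder α] (M : Matroid α) (I J : Set α) : Prop :=
  ∃ B : Set α, M.IsRelatedToBase I B ∧ M.IsRelatedToBase J B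

/-- Las Vergnas's external/internal order on bases. -/
def BaseExtIntLE {α : Type*} [LinearOrder α] (M : Matroid α) (A B : Set α) : Prop :=
  (A \ M.intActive A) ∪ M.extActive A ⊆ (B \ M.intActive B) ∪ M.extActive B

/-- The extended external/internal order on independent sets. -/
def IndepExtIntLE {α : Type*} [LinearOrder α] (M : Matroid α) (I J : Set α) : Prop :=
  (¬ M.InternallyRelated I J ∧
    (I \ M.intActive I) ∪ M.extActive I ⊆ (J \ M.intActive J) ∪ M.extActive J) ∨
  (M.InternallyRelated I J ∧ I ⊆ J)

/-- The collection of bases of `M`. (A structure rather than a subtype, so that it does not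
inherit the inclusion order.) -/
structure BaseSet {α : Type*} (M : Matroid α) where
  carrier : Set α
  isBase : M.IsBase carrier

/-- The collection of independent sets of `M`, without the inclusion order. -/
structure IndepSet {α : Type*} (M : Matroid α) where
  carrier : Set α
  indep : M.Indep carrier

end Matroid

open Set

namespace Matroid

/-! Write F(X) for `M.activeSpan X` and F* for the same operator of the dual; X is biclosed if F(X)
⊆ X and F*(E \ X) ⊆ E \ X. `extInt` maps bases bijectively onto biclosed sets, with inverse `toBase`
(`IsBase.toBase_extInt`, `Biclosed.extInt_toBase`), so the order on bases is inclusion of biclosed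
sets. These form a lattice: the F-closure of a union stays biclosed because a circuit and a
cocircuit never meet in a single element, and complementation in the dual turns joins into meets.

On independent sets, `extInt` is constant on each interval [IP(B), B], and these intervals partition
the independent sets. The order thus replaces each basis in the lattice of bases by a Boolean
interval, and `exists_lattice_of_fibres` computes joins and meets there. -/

lemma IsCircuit.exists_mem_ne {α : Type*} {M : Matroid α} {C K : Set α} {e : α} (hC : M.IsCircuit C)
    (hK : M✶.IsCircuit K) (heC : e ∈ C) (heK : e ∈ K) : ∃ f ∈ C, f ∈ K ∧ f ≠ e := by
  by_contra! h
  exact hC.inter_isCocircuit_ne_singleton hK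
    (eq_singleton_iff_unique_mem.2 ⟨⟨heC, heK⟩, fun x hx => h x hx.1 hx.2⟩)

variable {α : Type*} [LinearOrder α] {M : Matroid α} {X Y Z B I J C : Set α} {e : α}

/-! ### Active spans -/

/-- The elements spanned by the smaller elements of `X`. -/
def activeSpan (M : Matroid α) (X : Set α) : Set α :=
  {e | e ∈ M.closure (X ∩ Iio e)}

lemma activeSpan_subset_ground (M : Matroid α) (X : Set α) : M.activeSpan X ⊆ M.E :=
  fun _ he => M.closure_subset_ground _ he

lemma activeSpan_mono (M : Matroid α) (h : X ⊆ Y) : M.activeSpan X ⊆ M.activeSpan Y :=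
  fun _ he => M.closure_subset_closure (inter_subset_inter_left _ h) he

lemma mem_activeSpan_iff :
    e ∈ M.activeSpan X ↔ ∃ C, M.IsCircuit C ∧ IsGreatest C e ∧ C \ {e} ⊆ X := by
  rw [activeSpan, mem_ofPred_eq, mem_closure_iff_exists_isCircuit (by simp)]
  constructor
  · rintro ⟨C, hCX, hC, heC⟩
    refine ⟨C, hC, ⟨heC, fun x hx => ?_⟩, fun x hx => ?_⟩
    · rcases hCX hx with rfl | h
      exacts [le_rfl, h.2.le]
    · exact ((hCX hx.1).resolve_left hx.2).1
  · rintro ⟨C, hC, hCe, hCX⟩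
    refine ⟨C, fun x hx => ?_, hC, hCe.1⟩
    by_cases hxe : x = e
    · exact Or.inl hxe
    · exact Or.inr ⟨hCX ⟨hx, hxe⟩, lt_of_le_of_ne (hCe.2 hx) hxe⟩

lemma extActive_eq (M : Matroid α) (S : Set α) : M.extActive S = M.activeSpan S \ S := by
  ext e
  simp only [extActive, mem_ofPred_eq, mem_sdiff, mem_activeSpan_iff]
  constructor
  · rintro ⟨⟨-, heS⟩, C, hC, hCS, he⟩
    exact ⟨⟨C, hC, he, fun x hx => (hCS hx.1).resolve_left hx.2⟩, heS⟩
  · rintro ⟨⟨C, hC, he, hCS⟩, heS⟩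
    refine ⟨⟨hC.subset_ground he.1, heS⟩, C, hC, fun x hx => ?_, he⟩
    by_cases hxe : x = e
    · exact Or.inl hxe
    · exact Or.inr (hCS ⟨hx, hxe⟩)

lemma intActive_eq (hX : X ⊆ M.E) : M.intActive X = X ∩ M✶.activeSpan (M.E \ X) := by
  ext e
  simp only [intActive, extActive_eq, mem_ofPred_eq, mem_sdiff, mem_inter_iff]
  have := @hX e
  tauto

lemma activeSpan_subset_activeSpan (hX : X ⊆ M.E) (h : Y ⊆ X ∪ M.activeSpan X) :
    M.activeSpan Y ⊆ M.activeSpan X := by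
  intro e he
  refine closure_subset_closure_of_subset_closure (fun y hy => ?_) he
  rcases h hy.1 with hyX | hyX
  · exact M.mem_closure_of_mem' ⟨hyX, hy.2⟩ (hX hyX)
  · exact M.closure_subset_closure (inter_subset_inter_right _ (Iio_subset_Iio (le_of_lt hy.2))) hyX

lemma exists_isLeast_of_subset_ground [M.Finite] (hX : X ⊆ M.E) (h : X.Nonempty) : ∃ e, IsLeast X e := by
  obtain ⟨e, he, hmin⟩ := exists_min_image X id (M.set_finite X hX) h
  exact ⟨e, he, hmin⟩

/-- Below the least element lost, every deleted element is still spanned by what remains, so that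
element is not lost either. -/
lemma activeSpan_diff [M.Finite] (hX : X ⊆ M.E) (hY : Y ⊆ M.activeSpan X) :
    M.activeSpan (X \ Y) = M.activeSpan X := by
  refine (M.activeSpan_mono sdiff_subset).antisymm ?_
  by_contra hcon
  obtain ⟨e, ⟨heX, he⟩, hmin⟩ := exists_isLeast_of_subset_ground (M := M)
    (sdiff_subset.trans (M.activeSpan_subset_ground X)) (sdiff_nonempty.2 hcon)
  refine he (closure_subset_closure_of_subset_closure (fun y hy => ?_) heX)
  by_cases hyY : y ∈ Y
  · have : y ∈ M.activeSpan (X \ Y) := by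
      by_contra h
      exact (hmin ⟨hY hyY, h⟩).not_gt hy.2
    exact M.closure_subset_closure
      (inter_subset_inter_right _ (Iio_subset_Iio (le_of_lt hy.2))) this
  · exact M.mem_closure_of_mem' ⟨⟨hy.1, hyY⟩, hy.2⟩ (hX hy.1)

lemma Indep.disjoint_activeSpan (hI : M.Indep I) : Disjoint I (M.activeSpan I) := by
  rw [disjoint_left]
  intro e he h
  have hsub : I ∩ Iio e ⊆ I \ {e} := fun x hx => ⟨hx.1, ne_of_lt hx.2⟩
  exact hI.notMem_closure_sdiff_of_mem he (M.closure_subset_closure hsub h)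

lemma Indep.extActive_eq_activeSpan (hI : M.Indep I) : M.extActive I = M.activeSpan I := by
  rw [extActive_eq, hI.disjoint_activeSpan.symm.sdiff_eq_left]

/-- Orthogonality of circuits and cocircuits with the same maximum. -/
lemma exists_lt_of_mem_activeSpan (h : e ∈ M.activeSpan X) (h' : e ∈ M✶.activeSpan Y) :
    ∃ f < e, f ∈ X ∧ f ∈ Y := by
  obtain ⟨C, hC, hCe, hCX⟩ := mem_activeSpan_iff.1 h
  obtain ⟨D, hD, hDe, hDX⟩ := mem_activeSpan_iff.1 h'
  obtain ⟨f, hfC, hfD, hfe⟩ := hC.exists_mem_ne hD hCe.1 hDe.1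
  exact ⟨f, lt_of_le_of_ne (hCe.2 hfC) hfe, hCX ⟨hfC, hfe⟩, hDX ⟨hfD, hfe⟩⟩

/-- If a circuit with maximum e met an internally active i, the cocircuit with maximum i would meet
it again, necessarily at e, forcing e ≤ i. -/
lemma activeSpan_subset_intPassive (hI : I ⊆ M.E) :
    M.extActive I ⊆ M.activeSpan (M.intPassive I) := by
  rw [extActive_eq]
  rintro e ⟨he, heI⟩
  obtain ⟨C, hC, hCe, hCI⟩ := mem_activeSpan_iff.1 he
  refine mem_activeSpan_iff.2 ⟨C, hC, hCe, fun i hi => ⟨hCI hi, fun hia => ?_⟩⟩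
  rw [intActive_eq hI] at hia
  obtain ⟨D, hD, hDi, hDI⟩ := mem_activeSpan_iff.1 hia.2
  obtain ⟨f, hfC, hfD, hfi⟩ := hC.exists_mem_ne hD hi.1 hDi.1
  have hfe : f = e := by
    by_contra h
    exact (hDI ⟨hfD, hfi⟩).2 (hCI ⟨hfC, h⟩)
  subst hfe
  exact hfi (le_antisymm (hDi.2 hfD) (hCe.2 hi.1))

/-! ### Bases and biclosed sets -/

/-- The set compared by the external/internal order. -/
def extInt (M : Matroid α) (S : Set α) : Set α :=
  (S \ M.intActive S) ∪ M.extActive S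

lemma extInt_subset_ground (hX : X ⊆ M.E) : M.extInt X ⊆ M.E :=
  union_subset (sdiff_subset.trans hX) fun _ he => he.1.1

lemma Indep.activeSpan_extInt (hI : M.Indep I) : M.activeSpan (M.extInt I) = M.extActive I := by
  refine subset_antisymm ?_ ?_
  · rw [hI.extActive_eq_activeSpan]
    refine activeSpan_subset_activeSpan hI.subset_ground ?_
    exact union_subset_union sdiff_subset hI.extActive_eq_activeSpan.subset
  · exact (activeSpan_subset_intPassive hI.subset_ground).trans
      (M.activeSpan_mono subset_union_left)

lemma extActive_dual_compl (hX : X ⊆ M.E) : M✶.extActive (M.E \ X) = M.intActive X := by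
  ext e
  refine ⟨fun h => ⟨?_, h⟩, fun h => h.2⟩
  have := h.1
  rw [dual_ground, sdiff_sdiff_cancel_left hX] at this
  exact this

lemma intActive_dual_compl (hX : X ⊆ M.E) : M✶.intActive (M.E \ X) = M.extActive X := by
  have := extActive_dual_compl (M := M✶) (X := M.E \ X) sdiff_subset
  rw [dual_dual, dual_ground, sdiff_sdiff_cancel_left hX] at this
  exact this.symm

lemma IsBase.extInt_dual_compl (hB : M.IsBase B) : M✶.extInt (M.E \ B) = M.E \ M.extInt B := by
  rw [extInt, intActive_dual_compl hB.subset_ground, extActive_dual_compl hB.subset_ground, extInt]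
  have h1 : M.intActive B ⊆ B := fun _ h => h.1
  have h2 : M.extActive B ⊆ M.E \ B := fun _ h => h.1
  have hBE := hB.subset_ground
  ext e
  have := @h1 e
  have := @h2 e
  have := @hBE e
  simp only [mem_union, mem_sdiff] at *
  tauto

/-- Sets closed under active spans whose complements are closed under dual active spans. -/
structure Biclosed (M : Matroid α) (X : Set α) : Prop where
  subset_ground : X ⊆ M.E
  activeSpan_subset : M.activeSpan X ⊆ X
  dual_activeSpan_subset : M✶.activeSpan (M.E \ X) ⊆ M.E \ X

lemma Biclosed.dual (hX : M.Biclosed X) : M✶.Biclosed (M.E \ X) := by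
  refine ⟨sdiff_subset, hX.dual_activeSpan_subset, ?_⟩
  rw [dual_dual, dual_ground, sdiff_sdiff_cancel_left hX.subset_ground]
  exact hX.activeSpan_subset

lemma IsBase.activeSpan_dual (hB : M.IsBase B) :
    M✶.activeSpan (M.E \ M.extInt B) = M.intActive B := by
  rw [← hB.extInt_dual_compl, hB.compl_isBase_dual.indep.activeSpan_extInt,
    extActive_dual_compl hB.subset_ground]

lemma IsBase.biclosed_extInt (hB : M.IsBase B) : M.Biclosed (M.extInt B) := by
  refine ⟨extInt_subset_ground hB.subset_ground, ?_, ?_⟩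
  · rw [hB.indep.activeSpan_extInt]
    exact subset_union_right
  · rw [hB.activeSpan_dual]
    rintro e he
    refine ⟨hB.subset_ground he.1, ?_⟩
    rintro (h | h)
    · exact h.2 he
    · exact h.1.2 he.1

/-- The basis whose external/internal set is a given biclosed set. -/
def toBase (M : Matroid α) (X : Set α) : Set α :=
  (X \ M.activeSpan X) ∪ M✶.activeSpan (M.E \ X)

lemma IsBase.toBase_extInt (hB : M.IsBase B) : M.toBase (M.extInt B) = B := by
  rw [toBase, hB.activeSpan_dual, hB.indep.activeSpan_extInt, extInt]
  have h1 : M.intActive B ⊆ B := fun _ h => h.1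
  have h2 : M.extActive B ⊆ M.E \ B := fun _ h => h.1
  ext e
  have := @h1 e
  have := @h2 e
  simp only [mem_union, mem_sdiff] at *
  tauto

lemma Biclosed.toBase_dual (hX : M.Biclosed X) :
    M✶.toBase (M.E \ X) = M.E \ M.toBase X := by
  rw [toBase, toBase, dual_dual, dual_ground, sdiff_sdiff_cancel_left hX.subset_ground]
  obtain ⟨h1, h2, h3⟩ := hX
  ext e
  have := @h1 e
  have := @h2 e
  have := @h3 e
  simp only [mem_union, mem_sdiff] at *
  tauto

lemma Biclosed.indep_toBase [M.Finite] (hX : M.Biclosed X) : M.Indep (M.toBase X) := by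
  rw [indep_iff_forall_subset_not_isCircuit (I := M.toBase X)
    (union_subset (sdiff_subset.trans hX.subset_ground) (M✶.activeSpan_subset_ground _))]
  intro C hCB hC
  have hCX : C ⊆ X \ M.activeSpan X := by
    -- At the least such i, a cocircuit with maximum i and its other elements outside X meets C at a
    -- smaller element of the same kind.
    have hempty : ¬ (C ∩ M✶.activeSpan (M.E \ X)).Nonempty := by
      intro hne
      obtain ⟨i, ⟨hiC, hi⟩, hmin⟩ := exists_isLeast_of_subset_ground (M := M)
        (inter_subset_left.trans hC.subset_ground) hne
      obtain ⟨D, hD, hDi, hDX⟩ := mem_activeSpan_iff.1 hi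
      obtain ⟨f, hfC, hfD, hfi⟩ := hC.exists_mem_ne hD hiC hDi.1
      have hf : f ∈ M✶.activeSpan (M.E \ X) :=
        (hCB hfC).resolve_left fun h => (hDX ⟨hfD, hfi⟩).2 h.1
      exact hfi (le_antisymm (hDi.2 hfD) (hmin ⟨hfC, hf⟩))
    exact fun x hx => (hCB hx).resolve_right fun h => hempty ⟨x, hx, h⟩
  obtain ⟨m, hm, hmax⟩ := exists_max_image C id (M.set_finite C hC.subset_ground) hC.nonempty
  exact (hCX hm).2 (mem_activeSpan_iff.2
    ⟨C, hC, ⟨hm, hmax⟩, fun x hx => (hCX hx.1).1⟩)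

lemma Biclosed.isBase_toBase [M.Finite] (hX : M.Biclosed X) : M.IsBase (M.toBase X) := by
  refine hX.indep_toBase.isBase_of_spanning ?_
  rw [spanning_iff_compl_coindep hX.indep_toBase.subset_ground, coindep_def, ← hX.toBase_dual]
  exact hX.dual.indep_toBase

lemma Biclosed.subset_extInt_toBase [M.Finite] (hX : M.Biclosed X) :
    X ⊆ M.extInt (M.toBase X) := by
  intro e he
  by_cases heF : e ∈ M.activeSpan X
  · refine Or.inr ?_
    rw [hX.indep_toBase.extActive_eq_activeSpan]
    refine M.activeSpan_mono subset_union_left ?_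
    rwa [activeSpan_diff hX.subset_ground subset_rfl]
  · refine Or.inl ⟨Or.inl ⟨he, heF⟩, fun hia => ?_⟩
    obtain ⟨D, hD, hDe, hDB⟩ := mem_activeSpan_iff.1
      ((intActive_eq hX.indep_toBase.subset_ground).subset hia).2
    -- The least y in this set lies in F(X); a circuit with maximum y and the rest in X then meets D
    -- in X below y.
    by_cases hne : ((D \ {e}) ∩ X).Nonempty
    · obtain ⟨y, ⟨hyD, hyX⟩, hmin⟩ := exists_isLeast_of_subset_ground (M := M)
        (inter_subset_right.trans hX.subset_ground) hne
      have hyF : y ∈ M.activeSpan X := by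
        by_contra h
        exact (hDB hyD).2 (Or.inl ⟨hyX, h⟩)
      obtain ⟨C, hC, hCy, hCX⟩ := mem_activeSpan_iff.1 hyF
      obtain ⟨f, hfC, hfD, hfy⟩ := hC.exists_mem_ne hD hCy.1 hyD.1
      have hlt : f < y := lt_of_le_of_ne (hCy.2 hfC) hfy
      exact (hmin ⟨⟨hfD, (hlt.trans_le (hDe.2 hyD.1)).ne⟩, hCX ⟨hfC, hfy⟩⟩).not_gt hlt
    · refine (hX.dual_activeSpan_subset (mem_activeSpan_iff.2 ⟨D, hD, hDe, fun x hx => ?_⟩)).2 he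
      exact ⟨hD.subset_ground hx.1, fun hxX => hne ⟨x, hx, hxX⟩⟩

/-- The reverse inclusion is `Biclosed.subset_extInt_toBase` for the complement in the dual. -/
lemma Biclosed.extInt_toBase [M.Finite] (hX : M.Biclosed X) : M.extInt (M.toBase X) = X := by
  refine hX.subset_extInt_toBase.antisymm' ?_
  have h := hX.dual.subset_extInt_toBase
  rw [hX.toBase_dual, hX.isBase_toBase.extInt_dual_compl] at h
  intro e he
  by_contra heX
  exact (h ⟨extInt_subset_ground hX.isBase_toBase.subset_ground he, heX⟩).2 he

/-! ### Joins and meets of biclosed sets -/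

/-- The least set containing `X` that is closed under active spans. -/
def activeClosure (M : Matroid α) (X : Set α) : Set α :=
  ⋂₀ {Z | X ⊆ Z ∧ M.activeSpan Z ⊆ Z}

lemma subset_activeClosure (M : Matroid α) (X : Set α) : X ⊆ M.activeClosure X :=
  subset_sInter fun _ h => h.1

lemma activeClosure_subset (h : X ⊆ Z) (hZ : M.activeSpan Z ⊆ Z) : M.activeClosure X ⊆ Z :=
  sInter_subset_of_mem ⟨h, hZ⟩

lemma activeSpan_activeClosure_subset (M : Matroid α) (X : Set α) :
    M.activeSpan (M.activeClosure X) ⊆ M.activeClosure X :=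
  subset_sInter fun _ h => (M.activeSpan_mono (activeClosure_subset h.1 h.2)).trans h.2

/-- The right-hand side is itself closed under active spans. -/
lemma activeClosure_subset_union (M : Matroid α) (X : Set α) :
    M.activeClosure X ⊆ X ∪ M.activeSpan (M.activeClosure X) :=
  activeClosure_subset subset_union_left <| (M.activeSpan_mono (union_subset
    (M.subset_activeClosure X) (M.activeSpan_activeClosure_subset X))).trans subset_union_right

lemma Biclosed.activeClosure_union (hX : M.Biclosed X) (hY : M.Biclosed Y) :
    M.Biclosed (M.activeClosure (X ∪ Y)) := by
  refine ⟨activeClosure_subset (union_subset hX.subset_ground hY.subset_ground)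
    (M.activeSpan_subset_ground _), M.activeSpan_activeClosure_subset _, fun e he => ?_⟩
  have hsub := M.subset_activeClosure (X ∪ Y)
  refine ⟨M✶.activeSpan_subset_ground _ he, fun heZ => ?_⟩
  rcases M.activeClosure_subset_union _ heZ with (h | h) | h
  · exact (hX.dual_activeSpan_subset (M✶.activeSpan_mono
      (sdiff_subset_sdiff_right (subset_union_left.trans hsub)) he)).2 h
  · exact (hY.dual_activeSpan_subset (M✶.activeSpan_mono
      (sdiff_subset_sdiff_right (subset_union_right.trans hsub)) he)).2 h
  -- By orthogonality, f would lie both in the closure and in its complement.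
  · obtain ⟨f, -, hf, hf'⟩ := exists_lt_of_mem_activeSpan h he
    exact hf'.2 hf

lemma Biclosed.exists_join (hX : M.Biclosed X) (hY : M.Biclosed Y) :
    ∃ Z, M.Biclosed Z ∧ X ⊆ Z ∧ Y ⊆ Z ∧ ∀ W, M.Biclosed W → X ⊆ W → Y ⊆ W → Z ⊆ W :=
  ⟨_, hX.activeClosure_union hY, subset_union_left.trans (M.subset_activeClosure _),
    subset_union_right.trans (M.subset_activeClosure _),
    fun _ hW hXW hYW => activeClosure_subset (union_subset hXW hYW) hW.activeSpan_subset⟩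

lemma Biclosed.exists_meet (hX : M.Biclosed X) (hY : M.Biclosed Y) :
    ∃ Z, M.Biclosed Z ∧ Z ⊆ X ∧ Z ⊆ Y ∧ ∀ W, M.Biclosed W → W ⊆ X → W ⊆ Y → W ⊆ Z := by
  obtain ⟨Z, hZ, hXZ, hYZ, h⟩ := hX.dual.exists_join hY.dual
  refine ⟨M.E \ Z, by simpa using hZ.dual, sdiff_subset_comm.1 hXZ, sdiff_subset_comm.1 hYZ,
    fun W hW hWX hWY => ?_⟩
  have := h _ hW.dual (sdiff_subset_sdiff_right hWX) (sdiff_subset_sdiff_right hWY)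
  exact subset_sdiff.2 ⟨hW.subset_ground, (subset_sdiff.1 this).2.symm⟩

/-! ### Independent sets and their bases -/

lemma IsRelatedToBase.activeSpan_dual [M.Finite] (h : M.IsRelatedToBase I B) :
    M✶.activeSpan (M.E \ I) = M✶.activeSpan (M.E \ B) := by
  obtain ⟨hB, Y, hY, rfl⟩ := h
  refine (activeSpan_subset_activeSpan (M := M✶) sdiff_subset ?_).antisymm
    (M✶.activeSpan_mono (sdiff_subset_sdiff_right sdiff_subset))
  rintro e ⟨heE, he⟩
  by_cases heB : e ∈ B
  · by_cases heY : e ∈ Y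
    · exact Or.inr ((intActive_eq hB.subset_ground).subset (hY heY)).2
    · exact absurd ⟨heB, heY⟩ he
  · exact Or.inl ⟨heE, heB⟩

lemma IsRelatedToBase.subset (h : M.IsRelatedToBase I B) : I ⊆ B := by
  obtain ⟨-, Y, -, rfl⟩ := h
  exact sdiff_subset

lemma isRelatedToBase_iff : M.IsRelatedToBase I B ↔ M.IsBase B ∧ M.intPassive B ⊆ I ∧ I ⊆ B := by
  constructor
  · rintro ⟨hB, Y, hY, rfl⟩
    exact ⟨hB, sdiff_subset_sdiff_right hY, sdiff_subset⟩
  · rintro ⟨hB, h, h'⟩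
    exact ⟨hB, B \ I, sdiff_subset_comm.1 h, (sdiff_sdiff_cancel_left h').symm⟩

lemma IsRelatedToBase.extInt_eq [M.Finite] (h : M.IsRelatedToBase I B) :
    M.extInt I = M.extInt B := by
  obtain ⟨hB, hpI, hIB⟩ := isRelatedToBase_iff.1 h
  have hI := hB.indep.subset hIB
  have hext : M.extActive I = M.extActive B := by
    refine subset_antisymm ?_ ?_
    · rw [hI.extActive_eq_activeSpan, hB.indep.extActive_eq_activeSpan]
      exact M.activeSpan_mono hIB
    · rw [hI.extActive_eq_activeSpan]
      exact (activeSpan_subset_intPassive hB.subset_ground).trans (M.activeSpan_mono hpI)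
  rw [extInt, extInt, hext, intActive_eq hI.subset_ground, h.activeSpan_dual]
  rw [intPassive] at hpI
  rw [intActive_eq hB.subset_ground] at hpI ⊢
  congr 1
  ext e
  have := @hpI e
  have := @hIB e
  simp only [mem_sdiff, mem_inter_iff] at *
  tauto

lemma IsRelatedToBase.eq [M.Finite] (h : M.IsRelatedToBase I B) (h' : M.IsRelatedToBase I J) :
    B = J := by
  rw [← h.1.toBase_extInt, ← h'.1.toBase_extInt, ← h.extInt_eq, h'.extInt_eq]

/-- This is the greedy basis: the maximum of any circuit in X lies in F(X), so deleting F(X) breaks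
every circuit. -/
lemma isBasis_diff_activeSpan [M.Finite] (hX : X ⊆ M.E) :
    M.IsBasis (X \ M.activeSpan X) X := by
  have hsub : X \ M.activeSpan X ⊆ M.E := sdiff_subset.trans hX
  have hI : M.Indep (X \ M.activeSpan X) := by
    rw [indep_iff_forall_subset_not_isCircuit hsub]
    intro C hCX hC
    obtain ⟨m, hm, hmax⟩ := exists_max_image C id (M.set_finite C hC.subset_ground) hC.nonempty
    exact (hCX hm).2 (mem_activeSpan_iff.2
      ⟨C, hC, ⟨hm, hmax⟩, fun x hx => (hCX hx.1).1⟩)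
  refine hI.isBasis_of_subset_of_subset_closure sdiff_subset fun e he => ?_
  by_cases h : e ∈ M.activeSpan X
  · rw [← activeSpan_diff hX subset_rfl] at h
    exact M.closure_subset_closure inter_subset_left h
  · exact M.mem_closure_of_mem' ⟨he, h⟩ (hX he)

/-- Removing from E \ I its dual active span leaves a dual basis; its complement is I ∪ F*(E \ I).
The added elements are internally active because the removal does not change F*. -/
lemma Indep.exists_isRelatedToBase [M.Finite] (hI : M.Indep I) :
    ∃ B, M.IsRelatedToBase I B := by
  have hb := isBasis_diff_activeSpan (M := M✶) (X := M.E \ I) sdiff_subset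
  have hsp : M✶.Spanning (M.E \ I) := by
    rw [← dual_ground, ← coindep_iff_compl_spanning (M := M✶) hI.subset_ground, dual_coindep_iff]
    exact hI
  have hB := (hb.isBase_of_spanning hsp).compl_isBase_of_dual
  refine ⟨_, isRelatedToBase_iff.2 ⟨hB, ?_, ?_⟩⟩
  · rintro e ⟨he, hea⟩
    by_contra heI
    refine hea ?_
    rw [intActive_eq hB.subset_ground]
    refine ⟨he, ?_⟩
    rw [sdiff_sdiff_cancel_left (sdiff_subset.trans sdiff_subset),
      activeSpan_diff (M := M✶) (X := M.E \ I) sdiff_subset subset_rfl]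
    by_contra h
    exact he.2 ⟨⟨he.1, heI⟩, h⟩
  · exact fun e he => ⟨hI.subset_ground he, fun h => h.1.2 he⟩

end Matroid

/-! ### Lattices from relations and fibres -/

/-- A relation with the order axioms and with binary joins and meets is the order of a lattice. -/
lemma exists_lattice_of_rel {P : Type*} (r : P → P → Prop) (hrefl : ∀ a, r a a)
    (htrans : ∀ a b c, r a b → r b c → r a c) (hanti : ∀ a b, r a b → r b a → a = b)
    (hsup : ∀ a b, ∃ c, r a c ∧ r b c ∧ ∀ d, r a d → r b d → r c d)
    (hinf : ∀ a b, ∃ c, r c a ∧ r c b ∧ ∀ d, r d a → r d b → r d c) :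
    ∃ _ : Lattice P, ∀ a b : P, a ≤ b ↔ r a b := by
  choose s hs1 hs2 hs3 using hsup
  choose i hi1 hi2 hi3 using hinf
  exact ⟨{ le := r
           le_refl := hrefl
           le_trans := htrans
           le_antisymm := hanti
           sup := s
           le_sup_left := hs1
           le_sup_right := hs2
           sup_le := fun a b c => hs3 a b c
           inf := i
           inf_le_left := hi1
           inf_le_right := hi2
           le_inf := fun a b c => hi3 b c a }, fun _ _ => Iff.rfl⟩

/-- Replacing each element `q` of a lattice by an interval of sets, ordered by inclusion, gives
a lattice: elements of different fibres of `b` are compared through `b`, and elements of the same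
fibre by inclusion. -/
lemma exists_lattice_of_fibres {α P Q : Type*} [Lattice Q] (b : P → Q) (c : P → Set α)
    (bot top : Q → P) (hc : c.Injective) (hbot : ∀ q, b (bot q) = q) (htop : ∀ q, b (top q) = q)
    (hbot_le : ∀ p, c (bot (b p)) ⊆ c p) (hle_top : ∀ p, c p ⊆ c (top (b p)))
    (hunion : ∀ p p', b p = b p' → ∃ s, b s = b p ∧ c s = c p ∪ c p')
    (hinter : ∀ p p', b p = b p' → ∃ s, b s = b p ∧ c s = c p ∩ c p') :
    ∃ _ : Lattice P, (∀ p p' : P, p ≤ p' ↔ b p < b p' ∨ (b p = b p' ∧ c p ⊆ c p')) ∧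
      (∀ p p' : P, b p = b p' → c (p ⊓ p') = c p ∩ c p' ∧ c (p ⊔ p') = c p ∪ c p') ∧
      ∀ p p' : P, ¬ b p ≤ b p' → ¬ b p' ≤ b p →
        p ⊓ p' = top (b p ⊓ b p') ∧ p ⊔ p' = bot (b p ⊔ b p') := by
  set r : P → P → Prop := fun p p' => b p < b p' ∨ (b p = b p' ∧ c p ⊆ c p') with hr
  have hrb : ∀ {p p'}, r p p' → b p ≤ b p' := by
    rintro p p' (h | h)
    exacts [h.le, h.1.le]
  have hrefl : ∀ p, r p p := fun p => Or.inr ⟨rfl, subset_rfl⟩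
  have hS1 : ∀ p p' s, b p = b p' → b s = b p → c s = c p ∪ c p' →
      r p s ∧ r p' s ∧ ∀ d, r p d → r p' d → r s d := by
    intro p p' s h hs hcs
    refine ⟨Or.inr ⟨hs.symm, hcs ▸ subset_union_left⟩,
      Or.inr ⟨h.symm.trans hs.symm, hcs ▸ subset_union_right⟩, fun d hd hd' => ?_⟩
    rcases hd with hd | hd
    · exact Or.inl (hs ▸ hd)
    rcases hd' with hd' | hd'
    · exact Or.inl (by rwa [hs, h])
    · exact Or.inr ⟨hs.trans hd.1, hcs ▸ union_subset hd.2 hd'.2⟩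
  have hI1 : ∀ p p' s, b p = b p' → b s = b p → c s = c p ∩ c p' →
      r s p ∧ r s p' ∧ ∀ d, r d p → r d p' → r d s := by
    intro p p' s h hs hcs
    refine ⟨Or.inr ⟨hs, hcs ▸ inter_subset_left⟩,
      Or.inr ⟨hs.trans h, hcs ▸ inter_subset_right⟩, fun d hd hd' => ?_⟩
    rcases hd with hd | hd
    · exact Or.inl (hs ▸ hd)
    rcases hd' with hd' | hd'
    · exact Or.inl (by rwa [hs, h])
    · exact Or.inr ⟨hd.1.trans hs.symm, hcs ▸ subset_inter hd.2 hd'.2⟩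
  have hS2 : ∀ p p', ¬ b p ≤ b p' → ¬ b p' ≤ b p →
      r p (bot (b p ⊔ b p')) ∧ r p' (bot (b p ⊔ b p')) ∧
        ∀ d, r p d → r p' d → r (bot (b p ⊔ b p')) d := by
    intro p p' h h'
    refine ⟨Or.inl ?_, Or.inl ?_, fun d hd hd' => ?_⟩
    · rwa [hbot, left_lt_sup]
    · rwa [hbot, right_lt_sup]
    -- An upper bound may lie in the fibre over the join itself, hence the choice of the bottom of
    -- that fibre.
    · rcases (sup_le (hrb hd) (hrb hd')).lt_or_eq with hlt | heq
      · exact Or.inl (by rwa [hbot])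
      · exact Or.inr ⟨by rw [hbot, heq], heq ▸ hbot_le d⟩
  have hI2 : ∀ p p', ¬ b p ≤ b p' → ¬ b p' ≤ b p →
      r (top (b p ⊓ b p')) p ∧ r (top (b p ⊓ b p')) p' ∧
        ∀ d, r d p → r d p' → r d (top (b p ⊓ b p')) := by
    intro p p' h h'
    refine ⟨Or.inl ?_, Or.inl ?_, fun d hd hd' => ?_⟩
    · rwa [htop, inf_lt_left]
    · rwa [htop, inf_lt_right]
    · rcases (le_inf (hrb hd) (hrb hd')).lt_or_eq with hlt | heq
      · exact Or.inl (by rwa [htop])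
      · exact Or.inr ⟨by rw [htop, heq], heq ▸ hle_top d⟩
  obtain ⟨L, hL⟩ := exists_lattice_of_rel r hrefl
    (by
      rintro x y z (h | h) (h' | h')
      · exact Or.inl (h.trans h')
      · exact Or.inl (h'.1 ▸ h)
      · exact Or.inl (h.1 ▸ h')
      · exact Or.inr ⟨h.1.trans h'.1, h.2.trans h'.2⟩)
    (by
      rintro x y (h | h) (h' | h')
      · exact absurd h' h.asymm
      · exact absurd h'.1 h.ne'
      · exact absurd h.1 h'.ne'
      · exact hc (h.2.antisymm h'.2))
    (by
      intro x y
      by_cases h : b x = b y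
      · obtain ⟨s, hs⟩ := hunion x y h
        exact ⟨s, hS1 x y s h hs.1 hs.2⟩
      by_cases h1 : b x ≤ b y
      · exact ⟨y, Or.inl (lt_of_le_of_ne h1 h), hrefl y, fun _ _ hd => hd⟩
      by_cases h2 : b y ≤ b x
      · exact ⟨x, hrefl x, Or.inl (lt_of_le_of_ne h2 (Ne.symm h)), fun _ hd _ => hd⟩
      · exact ⟨_, hS2 x y h1 h2⟩)
    (by
      intro x y
      by_cases h : b x = b y
      · obtain ⟨s, hs⟩ := hinter x y h
        exact ⟨s, hI1 x y s h hs.1 hs.2⟩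
      by_cases h1 : b x ≤ b y
      · exact ⟨x, hrefl x, Or.inl (lt_of_le_of_ne h1 h), fun _ hd _ => hd⟩
      by_cases h2 : b y ≤ b x
      · exact ⟨y, Or.inl (lt_of_le_of_ne h2 (Ne.symm h)), hrefl y, fun _ _ hd => hd⟩
      · exact ⟨_, hI2 x y h1 h2⟩)
  have hsup : ∀ {x y s : P}, (r x s ∧ r y s ∧ ∀ d, r x d → r y d → r s d) → x ⊔ y = s := by
    rintro x y s ⟨h1, h2, h3⟩
    exact le_antisymm (sup_le ((hL _ _).2 h1) ((hL _ _).2 h2))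
      ((hL _ _).2 (h3 _ ((hL _ _).1 le_sup_left) ((hL _ _).1 le_sup_right)))
  have hinf : ∀ {x y s : P}, (r s x ∧ r s y ∧ ∀ d, r d x → r d y → r d s) → x ⊓ y = s := by
    rintro x y s ⟨h1, h2, h3⟩
    exact le_antisymm
      ((hL _ _).2 (h3 _ ((hL _ _).1 inf_le_left) ((hL _ _).1 inf_le_right)))
      (le_inf ((hL _ _).2 h1) ((hL _ _).2 h2))
  refine ⟨L, hL, fun x y h => ?_, fun x y h h' => ⟨hinf (hI2 x y h h'), hsup (hS2 x y h h')⟩⟩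
  obtain ⟨s, hs, hcs⟩ := hunion x y h
  obtain ⟨t, ht, hct⟩ := hinter x y h
  rw [hsup (hS1 x y s h hs hcs), hinf (hI1 x y t h ht hct)]
  exact ⟨hct, hcs⟩

/-! ### The lattices of bases and independent sets -/

namespace Matroid

variable {α : Type*} [LinearOrder α] {M : Matroid α} {A B I J : Set α}

lemma BaseSet.carrier_injective {α : Type*} {M : Matroid α} :
    (BaseSet.carrier : M.BaseSet → Set α).Injective := by
  rintro ⟨A, _⟩ ⟨B, _⟩ rfl
  rfl

lemma IndepSet.carrier_injective {α : Type*} {M : Matroid α} :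
    (IndepSet.carrier : M.IndepSet → Set α).Injective := by
  rintro ⟨A, _⟩ ⟨B, _⟩ rfl
  rfl

lemma exists_lattice_baseSet (M : Matroid α) [M.Finite] :
    ∃ _ : Lattice M.BaseSet, ∀ A B : M.BaseSet, A ≤ B ↔ M.BaseExtIntLE A.carrier B.carrier := by
  refine exists_lattice_of_rel (fun A B : M.BaseSet => M.BaseExtIntLE A.carrier B.carrier)
    (fun _ => subset_rfl) (fun _ _ _ => Subset.trans) (fun A B h h' => ?_) (fun A B => ?_)
    fun A B => ?_
  · apply BaseSet.carrier_injective
    rw [← A.isBase.toBase_extInt, ← B.isBase.toBase_extInt]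
    exact congrArg _ (Subset.antisymm h h')
  · obtain ⟨Z, hZ, hAZ, hBZ, h⟩ := A.isBase.biclosed_extInt.exists_join B.isBase.biclosed_extInt
    rw [← hZ.extInt_toBase] at hAZ hBZ h
    exact ⟨⟨_, hZ.isBase_toBase⟩, hAZ, hBZ, fun D => h _ D.isBase.biclosed_extInt⟩
  · obtain ⟨Z, hZ, hAZ, hBZ, h⟩ := A.isBase.biclosed_extInt.exists_meet B.isBase.biclosed_extInt
    rw [← hZ.extInt_toBase] at hAZ hBZ h
    exact ⟨⟨_, hZ.isBase_toBase⟩, hAZ, hBZ, fun D => h _ D.isBase.biclosed_extInt⟩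

lemma IsRelatedToBase.internallyRelated_iff [M.Finite] (hI : M.IsRelatedToBase I A)
    (hJ : M.IsRelatedToBase J B) : M.InternallyRelated I J ↔ A = B := by
  constructor
  · rintro ⟨D, hD, hD'⟩
    exact (hI.eq hD).trans (hD'.eq hJ)
  · rintro rfl
    exact ⟨A, hI, hJ⟩

lemma IsBase.isRelatedToBase_self (hB : M.IsBase B) : M.IsRelatedToBase B B :=
  isRelatedToBase_iff.2 ⟨hB, sdiff_subset, subset_rfl⟩

lemma IsBase.isRelatedToBase_intPassive (hB : M.IsBase B) :
    M.IsRelatedToBase (M.intPassive B) B :=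
  isRelatedToBase_iff.2 ⟨hB, subset_rfl, sdiff_subset⟩

lemma IsRelatedToBase.union (hI : M.IsRelatedToBase I B) (hJ : M.IsRelatedToBase J B) :
    M.IsRelatedToBase (I ∪ J) B := by
  rw [isRelatedToBase_iff] at *
  exact ⟨hI.1, hI.2.1.trans subset_union_left, union_subset hI.2.2 hJ.2.2⟩

lemma IsRelatedToBase.inter (hI : M.IsRelatedToBase I B) (hJ : M.IsRelatedToBase J B) :
    M.IsRelatedToBase (I ∩ J) B := by
  rw [isRelatedToBase_iff] at *
  exact ⟨hI.1, subset_inter hI.2.1 hJ.2.1, inter_subset_left.trans hI.2.2⟩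

lemma IsRelatedToBase.indep (h : M.IsRelatedToBase I B) : M.Indep I :=
  h.1.indep.subset h.subset

end Matroid

theorem mainTheorem8 {α : Type*} [LinearOrder α] (M : Matroid α) [M.Finite] :
    (∀ I : M.IndepSet, ∃! B : Set α, M.IsRelatedToBase I.carrier B) ∧
    ∃ (_ : Lattice M.BaseSet) (_ : Lattice M.IndepSet),
      (∀ A B : M.BaseSet, A ≤ B ↔ M.BaseExtIntLE A.carrier B.carrier) ∧
      (∀ I J : M.IndepSet, I ≤ J ↔ M.IndepExtIntLE I.carrier J.carrier) ∧
      (∀ I J : M.IndepSet, M.InternallyRelated I.carrier J.carrier →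
        (I ⊓ J).carrier = I.carrier ∩ J.carrier ∧
        (I ⊔ J).carrier = I.carrier ∪ J.carrier) ∧
      (∀ (I J : M.IndepSet) (A B : M.BaseSet),
        M.IsRelatedToBase I.carrier A.carrier → M.IsRelatedToBase J.carrier B.carrier →
        (¬ A ≤ B → ¬ B ≤ A →
          (I ⊓ J).carrier = (A ⊓ B).carrier ∧
          (I ⊔ J).carrier = M.intPassive (A ⊔ B).carrier) ∧
        (A < B → I ⊓ J = I ∧ I ⊔ J = J)) := by
  refine ⟨fun I => ?_, ?_⟩
  · obtain ⟨B, hB⟩ := I.indep.exists_isRelatedToBase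
    exact ⟨B, hB, fun B' hB' => hB'.eq hB⟩
  obtain ⟨LB, hLB⟩ := M.exists_lattice_baseSet
  have hex : ∀ I : M.IndepSet, ∃ B : M.BaseSet, M.IsRelatedToBase I.carrier B.carrier := by
    intro I
    obtain ⟨B, hB⟩ := I.indep.exists_isRelatedToBase
    exact ⟨⟨B, hB.1⟩, hB⟩
  choose b hb using hex
  have huniq : ∀ {I : M.IndepSet} {A : M.BaseSet},
      M.IsRelatedToBase I.carrier A.carrier → b I = A :=
    fun {I _} h => Matroid.BaseSet.carrier_injective ((hb I).eq h)
  have hrel : ∀ I J : M.IndepSet, M.InternallyRelated I.carrier J.carrier ↔ b I = b J :=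
    fun I J => ((hb I).internallyRelated_iff (hb J)).trans
      Matroid.BaseSet.carrier_injective.eq_iff
  have hb' : ∀ {I J : M.IndepSet}, b I = b J → M.IsRelatedToBase J.carrier (b I).carrier :=
    fun {_ J} h => h ▸ hb J
  obtain ⟨LI, hLI, hsame, hincomp⟩ := exists_lattice_of_fibres b Matroid.IndepSet.carrier
    (fun B => ⟨_, B.isBase.isRelatedToBase_intPassive.indep⟩) (fun B => ⟨_, B.isBase.indep⟩)
    Matroid.IndepSet.carrier_injective
    (fun B => huniq B.isBase.isRelatedToBase_intPassive)
    (fun B => huniq B.isBase.isRelatedToBase_self)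
    (fun I => (Matroid.isRelatedToBase_iff.1 (hb I)).2.1) (fun I => (hb I).subset)
    (fun I J h => ⟨⟨_, ((hb I).union (hb' h)).indep⟩, huniq ((hb I).union (hb' h)), rfl⟩)
    (fun I J h => ⟨⟨_, ((hb I).inter (hb' h)).indep⟩, huniq ((hb I).inter (hb' h)), rfl⟩)
  refine ⟨LB, LI, hLB, fun I J => ?_, fun I J h => hsame I J ((hrel I J).1 h), ?_⟩
  · rw [hLI, Matroid.IndepExtIntLE, hrel, lt_iff_le_and_ne, hLB]
    have hext : ∀ I : M.IndepSet, M.extInt I.carrier = M.extInt (b I).carrier :=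
      fun I => (hb I).extInt_eq
    -- Both orders compare `extInt`, which takes the same value at I and at its basis.
    change M.extInt _ ⊆ M.extInt _ ∧ _ ∨ _ ↔ (_ ∧ M.extInt _ ⊆ M.extInt _) ∨ _
    rw [hext I, hext J, and_comm]
  · intro I J A B hIA hJB
    obtain rfl := huniq hIA
    obtain rfl := huniq hJB
    refine ⟨fun h h' => ?_, fun h => ?_⟩
    · obtain ⟨h1, h2⟩ := hincomp I J h h'
      exact ⟨congrArg _ h1, congrArg _ h2⟩
    · have hIJ : I ≤ J := (hLI I J).2 (Or.inl h)
      exact ⟨inf_eq_left.2 hIJ, sup_eq_right.2 hIJ⟩
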